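/- **Setting.** A target language model and $K\ge 1$ drafters $i\in[K]$ share a finite vocabulary. For each token position $t$ let $p^t$ and $q_i^t$ be the (random) next-token distributions of the target model and of drafter $i$, and let $\alpha_{i,t}=1-d_{TV}(p^t,q_i^t)$. A token drafted by $i$ at position $t$ is accepted with probability $\alpha_{i,t}$. Assume stationarity: for each $i$ the rates $\alpha_{i,t}$ are i.i.d. over $t$ with a law $\nu_i$ of mean $\alpha_i$, and rates and verifications at different positions are independent (different drafters may be dependent at the same position). Let $i^\star$ be a drafter with $\alpha_{i^\star}=\max_i\alpha_i$. One round with drafter $i$ drafts $N_{max}\ge1$ tokens; $N_{acc}$ is the length of the initial run of accepted tokens, and the round generates $N_{acc}+1$ tokens. The block-efficiency (BE) reward is $r_i^{BE}=N_{acc}/N_{max}$; put $\mu_i^{BE}=\mathbb E[r_i^{BE}]$ and $\Delta_i^{BE}=\mu^{BE}_{i^\star}-\mu_i^{BE}$. A policy chooses the drafter of the next round from the drafters used and the numbers of accepted tokens observed so far; $\tau(\pi,B)$ is the number of rounds after which the policy $\pi$ has generated at least $B$ tokens. MetaSD-UCB with the BE reward and exploration parameter $\beta$ first plays one round with each drafter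 and then, as long as fewer than $B$ tokens have been generated, plays a drafter maximizing $$\hat\mu_i+\beta\sqrt{\frac{2\ln t}{n_i}},$$ where $t$ is the number of rounds played so far, $n_i$ the number of those with drafter $i$ and $\hat\mu_i$ the average BE reward in them (ties are broken arbitrarily). Its regret $\mathrm{Reg}(\pi^{BE},B)$ is its expected number of rounds minus $\min_\pi\mathbb E[\tau(\pi,B)]$. **Theorem.** For all $K$, $N_{max}$ and every value of $\alpha_{i^\star}$ there are constants $C,C'>0$, depending only on $K$, $N_{max}$ and $\alpha_{i^\star}$ (so independent of $B$, of the suboptimal drafters and of the gaps $\Delta_i^{BE}$), such that the following holds. If $\mathrm{Var}[r_i^{BE}]<\mathrm{Var}[r_{i^\star}^{BE}]$ for all $i\ne i^\star$, then for every exploration parameter $\beta$ with $1\le\beta\le\sqrt{4\mathrm{Var}[r_{i^\star}^{BE}]+2}$ and every $B\ge 1$, $$\mathrm{Reg}(\pi^{BE},B)\le\sum_{i\ne i^\star}\frac{32\mathrm{Var}[r_{i^\star}^{BE}]+16}{(\Delta_i^{BE})^2}\Big(\ln B+\ln\ln\Big(\sum_{j\neq i^\star}\frac1{(\Delta_j^{BE})^2}\Big)+C'\Big)+C.$$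 -/

import Mathlib

open MeasureTheory ProbabilityTheory

noncomputable section

namespace MetaSD

/-- Total variation distance of two probability vectors on a finite vocabulary. -/
def tvDist {V : Type*} [Fintype V] (p q : V → ℝ) : ℝ :=
  (1 / 2) * ∑ v, |p v - q v|

/-- Multi-drafter speculative decoding with `K` drafters over the vocabulary `V`.
For every token position `t`, `target t` is the next-token distribution of the target model and
`drafter i t` that of drafter `i`; both are random since the context is.
`coin i t` is the uniform variable used to verify the token drafted by `i` at position `t`. -/
structure Decoding (K : ℕ) (V Ω : Type*) [Fintype V] [MeasurableSpace Ω] where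
  target : ℕ → Ω → V → ℝ
  drafter : Fin K → ℕ → Ω → V → ℝ
  coin : Fin K → ℕ → Ω → ℝ
  target_mem : ∀ t ω, target t ω ∈ stdSimplex ℝ V
  drafter_mem : ∀ i t ω, drafter i t ω ∈ stdSimplex ℝ V
  measurable_target : ∀ t, Measurable (target t)
  measurable_drafter : ∀ i t, Measurable (drafter i t)
  measurable_coin : ∀ i t, Measurable (coin i t)

/-- What a drafter-selection policy has observed: the pairs (drafter, number of accepted tokens)
of the rounds played so far, latest round first. -/
abbrev History (K : ℕ) : Type := List (Fin K × ℕ)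

/-- A policy chooses the drafter of the next round from the history. -/
abbrev Policy (K : ℕ) : Type := History K → Fin K

/-- Number of tokens generated so far: a round with `k` accepted tokens yields `k + 1` tokens. -/
def tokens {K : ℕ} (h : History K) : ℕ := (h.map fun x => x.2 + 1).sum

/-- Number of rounds in which drafter `i` was used. -/
def pulls {K : ℕ} (h : History K) (i : Fin K) : ℕ := h.countP fun x => x.1 = i

/-- Empirical mean of the block-efficiency rewards `N_acc / N_max` collected from drafter `i`. -/
def empMean {K : ℕ} (N : ℕ) (h : History K) (i : Fin K) : ℝ :=
  ((h.filter fun x => x.1 = i).map fun x => (x.2 : ℝ) / N).sum / pulls h i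

/-- The upper confidence index of drafter `i` after the rounds recorded in `h`. -/
def ucbIndex {K : ℕ} (N : ℕ) (β : ℝ) (h : History K) (i : Fin K) : ℝ :=
  empMean N h i + β * Real.sqrt (2 * Real.log h.length / pulls h i)

/-- `π` is MetaSD-UCB with the block-efficiency reward and exploration parameter `β`: every drafter
is used once in the first `K` rounds, then a maximizer of the index is used (ties are broken in an
arbitrary way). -/
def IsMetaSDUCB {K : ℕ} (N : ℕ) (β : ℝ) (π : Policy K) : Prop :=
  (∀ (h : History K) (hh : h.length < K), π h = ⟨h.length, hh⟩) ∧
  (∀ h : History K, K ≤ h.length → ∀ j, ucbIndex N β h j ≤ ucbIndex N β h (π h))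

namespace Decoding

variable {K : ℕ} {V Ω : Type*} [Fintype V] [MeasurableSpace Ω]

/-- The acceptance rate `α_{i,t} = 1 - d_TV(p^t, q_i^t)`. -/
def accRate (S : Decoding K V Ω) (i : Fin K) (t : ℕ) (ω : Ω) : ℝ :=
  1 - tvDist (S.target t ω) (S.drafter i t ω)

/-- The token drafted by `i` at position `t` passes verification; given the rate `α_{i,t}` this
happens with probability `α_{i,t}`. -/
def Accepted (S : Decoding K V Ω) (i : Fin K) (t : ℕ) (ω : Ω) : Prop :=
  S.coin i t ω < S.accRate i t ω

/-- Stationary alignment: the acceptance rates of drafter `i` are i.i.d. over the token positions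
with law `ν i`, and verification uses fresh uniform variables. Different drafters may be dependent
at the same position. -/
structure IsStationary (S : Decoding K V Ω) (P : Measure Ω) (ν : Fin K → Measure ℝ) : Prop where
  rate_law : ∀ i t, P.map (S.accRate i t) = ν i
  coin_law : ∀ i t, P.map (S.coin i t) = volume.restrict (Set.Icc (0 : ℝ) 1)
  rate_coin_indep : ∀ i t, IndepFun (S.accRate i t) (S.coin i t) P
  position_indep :
    iIndepFun (fun (t : ℕ) (ω : Ω) (i : Fin K) => (S.accRate i t ω, S.coin i t ω)) P

open Classical in
/-- Number of accepted tokens when drafter `i` drafts the `N` tokens at positions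
`l, …, l + N - 1`: the length of the initial run of accepted tokens. -/
def nAcc (S : Decoding K V Ω) (N : ℕ) (i : Fin K) (l : ℕ) (ω : Ω) : ℕ :=
  ((Finset.range N).filter fun m => ∀ j ≤ m, S.Accepted i (l + j) ω).card

/-- The block-efficiency reward of one round of drafter `i` that starts at position `l`. -/
def beReward (S : Decoding K V Ω) (N : ℕ) (i : Fin K) (l : ℕ) (ω : Ω) : ℝ :=
  (S.nAcc N i l ω : ℝ) / N

/-- `μ_i^BE`, the expected reward of a round of drafter `i`; under stationarity the law of the
reward does not depend on the position at which the round starts. -/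
def beMean (S : Decoding K V Ω) (P : Measure Ω) (N : ℕ) (i : Fin K) : ℝ :=
  ∫ ω, S.beReward N i 0 ω ∂P

/-- `Var[r_i^BE]`. -/
def beVar (S : Decoding K V Ω) (P : Measure Ω) (N : ℕ) (i : Fin K) : ℝ :=
  variance (S.beReward N i 0) P

/-- The gap `Δ_i^BE` of drafter `i` with respect to the drafter `s`. -/
def beGap (S : Decoding K V Ω) (P : Measure Ω) (N : ℕ) (s i : Fin K) : ℝ :=
  S.beMean P N s - S.beMean P N i

/-- The history after `t` rounds under the policy `π`. -/
def hist (S : Decoding K V Ω) (N : ℕ) (π : Policy K) : ℕ → Ω → History K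
  | 0, _ => []
  | t + 1, ω =>
    (π (S.hist N π t ω),
      S.nAcc N (π (S.hist N π t ω)) (tokens (S.hist N π t ω)) ω) :: S.hist N π t ω

/-- `τ(π, B)`: the number of rounds after which `B` tokens have been generated. -/
def rounds (S : Decoding K V Ω) (N : ℕ) (π : Policy K) (B : ℕ) (ω : Ω) : ℕ :=
  sInf {t | B ≤ tokens (S.hist N π t ω)}

/-- The number of rounds of MetaSD-UCB: its initialization plays `K` rounds in any case, and only
then it checks whether `B` tokens have been generated. -/
def ucbRounds (S : Decoding K V Ω) (N : ℕ) (π : Policy K) (B : ℕ) (ω : Ω) : ℕ :=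
  max K (S.rounds N π B ω)

/-- `E[τ(π*, B)]`, the least expected number of rounds over all policies. -/
def optimalRounds (S : Decoding K V Ω) (P : Measure Ω) (N B : ℕ) : ℝ :=
  ⨅ π : Policy K, ∫ ω, (S.rounds N π B ω : ℝ) ∂P

/-- Stopping time regret of MetaSD-UCB: the expected number of rounds minus that of an optimal
policy. -/
def ucbRegret (S : Decoding K V Ω) (P : Measure Ω) (N : ℕ) (π : Policy K) (B : ℕ) : ℝ :=
  (∫ ω, (S.ucbRounds N π B ω : ℝ) ∂P) - S.optimalRounds P N B

end Decoding

end MetaSD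

end

namespace MetaSD

/-! Write `s` for the best drafter, μ_i and Δ_i for the BE means and gaps, and M = 1 + N μ_s for the
expected number of tokens in a round of `s`. A round that accepts k tokens inspects k + 1 positions
at most and advances by k + 1, so each round uses fresh positions. Given the history, its acceptance
count is therefore distributed as in a round of the chosen drafter started at position 0.

Wald's identity then handles both sides of the regret. Any policy satisfies B ≤ M E[τ]
(`le_integral_rounds`). For a given policy, M E[τ] ≤ B + N + ∑ N Δ_i E[pulls_i], where N bounds the
overshoot and the pulls are counted over B rounds, since τ ≤ B (`integral_rounds_le`). As N Δ_i ≤ M,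
dividing by M bounds the regret by the expected suboptimal pulls plus K + N (`ucbRegret_le`).

The pulls are bounded by the classical UCB1 argument: an exponential supermartingale and a union
bound over the number of pulls give E[pulls_i] ≤ 8β² ln B / Δ_i² + K + 5 (`integral_pulls_le`). The
upper bound on β gives 8β² ≤ 32 Var + 16.

The double logarithm plays no probabilistic role; it only has to stay nonnegative once C' is added.
If a suboptimal drafter exists, the variance assumption forces 0 < αs < 1, and Δ_i ≤ αs gives ∑
1/Δ_j² ≥ 1/αs² > 1. So ln ln(1/αs²) is a lower bound that C' can absorb. -/

theorem tvDist_nonneg {V : Type*} [Fintype V] (p q : V → ℝ) : 0 ≤ tvDist p q := by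
  unfold tvDist; positivity

theorem tvDist_le_one {V : Type*} [Fintype V] {p q : V → ℝ} (hp : p ∈ stdSimplex ℝ V)
    (hq : q ∈ stdSimplex ℝ V) : tvDist p q ≤ 1 := by
  have h : ∑ v, |p v - q v| ≤ ∑ v, (p v + q v) := by
    refine Finset.sum_le_sum fun v _ => ?_
    rw [abs_le]
    constructor <;> linarith [hp.1 v, hq.1 v]
  rw [Finset.sum_add_distrib, hp.2, hq.2] at h
  unfold tvDist
  linarith

namespace Decoding

variable {K : ℕ} {V Ω : Type*} [Fintype V] [MeasurableSpace Ω]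

/-! ### Acceptance rates and the token positions that determine a history. -/

theorem accRate_mem_Icc (S : Decoding K V Ω) (i : Fin K) (t : ℕ) (ω : Ω) :
    S.accRate i t ω ∈ Set.Icc (0 : ℝ) 1 := by
  unfold accRate
  constructor
  · linarith [tvDist_le_one (S.target_mem t ω) (S.drafter_mem i t ω)]
  · linarith [tvDist_nonneg (S.target t ω) (S.drafter i t ω)]

theorem measurable_accRate (S : Decoding K V Ω) (i : Fin K) (t : ℕ) :
    Measurable (S.accRate i t) := by
  have h1 := S.measurable_target t
  have h2 := S.measurable_drafter i t
  unfold accRate tvDist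
  refine measurable_const.sub (measurable_const.mul (Finset.measurable_sum _ fun v _ => ?_))
  exact (((measurable_pi_apply v).comp h1).sub ((measurable_pi_apply v).comp h2)).norm

/-- The acceptance rates and verification variables of all drafters at one position. -/
noncomputable def posVar (S : Decoding K V Ω) (t : ℕ) (ω : Ω) (i : Fin K) : ℝ × ℝ :=
  (S.accRate i t ω, S.coin i t ω)

theorem measurable_posVar (S : Decoding K V Ω) (t : ℕ) : Measurable (S.posVar t) :=
  measurable_pi_lambda _ fun i => (S.measurable_accRate i t).prodMk (S.measurable_coin i t)

/-- The σ-algebra generated by the positions in `A`. -/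
noncomputable abbrev posSigma (S : Decoding K V Ω) (A : Set ℕ) : MeasurableSpace Ω :=
  ⨆ t ∈ A, MeasurableSpace.comap (S.posVar t) inferInstance

theorem posSigma_mono (S : Decoding K V Ω) {A B : Set ℕ} (h : A ⊆ B) :
    S.posSigma A ≤ S.posSigma B :=
  biSup_mono h

theorem posSigma_le (S : Decoding K V Ω) (A : Set ℕ) :
    S.posSigma A ≤ (inferInstance : MeasurableSpace Ω) :=
  iSup₂_le fun t _ => (S.measurable_posVar t).comap_le

theorem measurableSet_accepted_comap (S : Decoding K V Ω) (i : Fin K) (t : ℕ) :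
    MeasurableSet[MeasurableSpace.comap (S.posVar t) inferInstance] {ω | S.Accepted i t ω} :=
  ⟨{f | (f i).2 < (f i).1}, measurableSet_lt (by fun_prop) (by fun_prop), rfl⟩

theorem measurableSet_accepted (S : Decoding K V Ω) {A : Set ℕ} (i : Fin K) {t : ℕ}
    (ht : t ∈ A) : MeasurableSet[S.posSigma A] {ω | S.Accepted i t ω} :=
  le_iSup₂_of_le (f := fun t (_ : t ∈ A) => MeasurableSpace.comap (S.posVar t) inferInstance)
    t ht le_rfl _ (S.measurableSet_accepted_comap i t)

theorem le_nAcc_iff (S : Decoding K V Ω) (N : ℕ) (i : Fin K) (l k : ℕ) (ω : Ω) :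
    k ≤ S.nAcc N i l ω ↔ k ≤ N ∧ ∀ m < k, S.Accepted i (l + m) ω := by
  classical
  unfold nAcc
  constructor
  · intro h
    have hkN : k ≤ N := h.trans ((Finset.card_filter_le _ _).trans_eq (Finset.card_range N))
    refine ⟨hkN, fun m hm => ?_⟩
    by_contra hc
    have hsub : ((Finset.range N).filter fun m => ∀ j ≤ m, S.Accepted i (l + j) ω)
        ⊆ Finset.range m := by
      intro x hx
      rw [Finset.mem_filter] at hx
      rw [Finset.mem_range]
      by_contra hmx
      exact hc (hx.2 m (not_lt.1 hmx))
    have h2 := Finset.card_le_card hsub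
    rw [Finset.card_range] at h2
    have h3 := h.trans (le_of_eq_of_le (by congr) h2)
    omega
  · rintro ⟨hkN, h⟩
    have hsub : Finset.range k ⊆
        ((Finset.range N).filter fun m => ∀ j ≤ m, S.Accepted i (l + j) ω) := by
      intro x hx
      rw [Finset.mem_range] at hx
      exact Finset.mem_filter.2 ⟨Finset.mem_range.2 (by omega), fun j hj => h j (by omega)⟩
    have h2 := Finset.card_le_card hsub
    rw [Finset.card_range] at h2
    exact h2.trans (le_of_eq (by congr))

theorem nAcc_le (S : Decoding K V Ω) (N : ℕ) (i : Fin K) (l : ℕ) (ω : Ω) :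
    S.nAcc N i l ω ≤ N :=
  ((S.le_nAcc_iff N i l _ ω).1 le_rfl).1

theorem measurableSet_le_nAcc (S : Decoding K V Ω) (N : ℕ) (i : Fin K) (l k : ℕ) :
    MeasurableSet[S.posSigma (Set.Ico l (l + k))] {ω | k ≤ S.nAcc N i l ω} := by
  by_cases hk : k ≤ N
  · have : {ω | k ≤ S.nAcc N i l ω} = ⋂ m ∈ Finset.range k, {ω | S.Accepted i (l + m) ω} := by
      ext ω; simp [le_nAcc_iff, hk]
    rw [this]
    refine Finset.measurableSet_biInter _ fun m hm => S.measurableSet_accepted i ?_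
    rw [Finset.mem_range] at hm
    exact ⟨by omega, by omega⟩
  · have : {ω | k ≤ S.nAcc N i l ω} = ∅ := by
      ext ω; simp [le_nAcc_iff, hk]
    rw [this]
    exact @MeasurableSet.empty _ (_)

/-- Positions after the first rejection, at `l + k`, are irrelevant even though `N` tokens were
drafted. -/
theorem measurableSet_nAcc_eq (S : Decoding K V Ω) (N : ℕ) (i : Fin K) (l k : ℕ) :
    MeasurableSet[S.posSigma (Set.Ico l (l + k + 1))] {ω | S.nAcc N i l ω = k} := by
  have : {ω | S.nAcc N i l ω = k} = {ω | k ≤ S.nAcc N i l ω} \ {ω | k + 1 ≤ S.nAcc N i l ω} := by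
    ext ω; simp only [Set.mem_ofPred_eq, Set.mem_sdiff]; omega
  rw [this]
  exact ((S.posSigma_mono (Set.Ico_subset_Ico_right (by omega))) _
    (S.measurableSet_le_nAcc N i l k)).diff (S.measurableSet_le_nAcc N i l (k + 1))

theorem tokens_cons (x : Fin K × ℕ) (h : History K) : tokens (x :: h) = x.2 + 1 + tokens h := by
  simp [tokens]

/-- The random starting positions cause no dependence: a round started at l with k acceptances is
decided by positions up to l + k, and the next round starts at l + k + 1. -/
theorem measurableSet_hist_eq (S : Decoding K V Ω) (N : ℕ) (π : Policy K) (t : ℕ)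
    (h : History K) :
    MeasurableSet[S.posSigma (Set.Iio (tokens h))] {ω | S.hist N π t ω = h} := by
  induction t generalizing h with
  | zero => exact @MeasurableSet.const _ (_) ([] = h)
  | succ t ih =>
    cases h with
    | nil =>
      have : {ω | S.hist N π (t + 1) ω = []} = ∅ := by ext ω; simp [hist]
      rw [this]; exact @MeasurableSet.empty _ (_)
    | cons x h =>
      obtain ⟨i, k⟩ := x
      by_cases hi : π h = i
      · have : {ω | S.hist N π (t + 1) ω = (i, k) :: h} =
            {ω | S.hist N π t ω = h} ∩ {ω | S.nAcc N i (tokens h) ω = k} := by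
          ext ω
          simp only [hist, List.cons.injEq, Prod.mk.injEq, Set.mem_ofPred_eq, Set.mem_inter_iff]
          constructor
          · rintro ⟨⟨h1, h2⟩, h3⟩
            rw [h3, hi] at h2
            exact ⟨h3, h2⟩
          · rintro ⟨h3, h2⟩
            rw [h3, hi]
            exact ⟨⟨rfl, h2⟩, rfl⟩
        rw [this, tokens_cons]
        refine MeasurableSet.inter (S.posSigma_mono ?_ _ (ih h))
          (S.posSigma_mono ?_ _ (S.measurableSet_nAcc_eq N i _ k))
        · exact Set.Iio_subset_Iio (by omega)
        · intro j hj
          simp only [Set.mem_Ico, Set.mem_Iio] at hj ⊢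
          omega
      · have : {ω | S.hist N π (t + 1) ω = (i, k) :: h} = ∅ := by
          ext ω
          simp only [hist, List.cons.injEq, Prod.mk.injEq, Set.mem_ofPred_eq, Set.mem_empty_iff_false,
            iff_false]
          rintro ⟨⟨h1, h2⟩, h3⟩
          exact hi (by rw [← h3]; exact h1)
        rw [this]; exact @MeasurableSet.empty _ (_)

/-! ### Law of the number of accepted tokens. -/

section law

variable {S : Decoding K V Ω} {P : Measure Ω} {ν : Fin K → Measure ℝ}

theorem IsStationary.iIndep_posVar (hS : S.IsStationary P ν) :
    iIndep (fun t => MeasurableSpace.comap (S.posVar t) inferInstance) P :=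
  hS.position_indep

theorem IsStationary.indep_posSigma (hS : S.IsStationary P ν) {A B : Set ℕ} (h : Disjoint A B) :
    Indep (S.posSigma A) (S.posSigma B) P :=
  indep_iSup_of_disjoint (fun t => (S.measurable_posVar t).comap_le) hS.iIndep_posVar h

theorem IsStationary.integral_rate (hS : S.IsStationary P ν) (i : Fin K) (t : ℕ) :
    ∫ x, x ∂(ν i) = ∫ ω, S.accRate i t ω ∂P := by
  rw [← hS.rate_law i t]
  exact integral_map (S.measurable_accRate i t).aemeasurable aestronglyMeasurable_id

/-- Fubini for the independent pair (rate, coin): a uniform coin falls below a fixed a ∈ [0,1] with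
probability a. -/
theorem IsStationary.measure_accepted [IsProbabilityMeasure P] (hS : S.IsStationary P ν)
    (i : Fin K) (t : ℕ) : P.real {ω | S.Accepted i t ω} = ∫ x, x ∂(ν i) := by
  have hm := S.measurable_accRate i t
  have hc := S.measurable_coin i t
  have hprod := (indepFun_iff_map_prod_eq_prod_map_map hm.aemeasurable hc.aemeasurable).1
    (hS.rate_coin_indep i t)
  have hset : MeasurableSet {x : ℝ × ℝ | x.2 < x.1} :=
    measurableSet_lt measurable_snd measurable_fst
  have h1 : P {ω | S.Accepted i t ω} = ∫⁻ ω, ENNReal.ofReal (S.accRate i t ω) ∂P := by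
    have : {ω | S.Accepted i t ω} =
      (fun ω => (S.accRate i t ω, S.coin i t ω)) ⁻¹' {x : ℝ × ℝ | x.2 < x.1} := rfl
    have : IsProbabilityMeasure (P.map (S.coin i t)) :=
      Measure.isProbabilityMeasure_map hc.aemeasurable
    rw [‹{ω | S.Accepted i t ω} = _›, ← Measure.map_apply (hm.prodMk hc) hset, hprod,
      Measure.prod_apply hset, lintegral_map (measurable_measure_prodMk_left hset) hm]
    refine lintegral_congr fun ω => ?_
    obtain ⟨h0, h1⟩ := S.accRate_mem_Icc i t ω
    rw [hS.coin_law i t]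
    have : Prod.mk (S.accRate i t ω) ⁻¹' {x : ℝ × ℝ | x.2 < x.1} = Set.Iio (S.accRate i t ω) := by
      ext; simp
    rw [this, Measure.restrict_apply measurableSet_Iio]
    have : Set.Iio (S.accRate i t ω) ∩ Set.Icc 0 1 = Set.Ico 0 (S.accRate i t ω) := by
      ext x; simp only [Set.mem_inter_iff, Set.mem_Iio, Set.mem_Icc, Set.mem_Ico]
      constructor
      · rintro ⟨a, b, c⟩; exact ⟨b, a⟩
      · rintro ⟨a, b⟩; exact ⟨b, a, by linarith⟩
    rw [this, Real.volume_Ico, sub_zero]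
  have hint : Integrable (S.accRate i t) P :=
    Integrable.of_bound hm.aestronglyMeasurable 1 (Filter.Eventually.of_forall fun ω => by
      obtain ⟨h0, h1⟩ := S.accRate_mem_Icc i t ω
      rw [Real.norm_eq_abs, abs_of_nonneg h0]; exact h1)
  have h2 : 0 ≤ ∫ ω, S.accRate i t ω ∂P :=
    integral_nonneg fun ω => (S.accRate_mem_Icc i t ω).1
  rw [hS.integral_rate i t, Measure.real, h1,
    ← ofReal_integral_eq_lintegral_ofReal hint
      (Filter.Eventually.of_forall fun ω => (S.accRate_mem_Icc i t ω).1),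
    ENNReal.toReal_ofReal h2]

theorem IsStationary.mean_mem_Icc [IsProbabilityMeasure P] (hS : S.IsStationary P ν) (i : Fin K) :
    ∫ x, x ∂(ν i) ∈ Set.Icc (0 : ℝ) 1 := by
  rw [← hS.measure_accepted i 0]
  exact ⟨measureReal_nonneg, measureReal_le_one⟩

theorem IsStationary.measure_le_nAcc [IsProbabilityMeasure P] (hS : S.IsStationary P ν)
    {N k : ℕ} (i : Fin K) (l : ℕ) (hk : k ≤ N) :
    P.real {ω | k ≤ S.nAcc N i l ω} = (∫ x, x ∂(ν i)) ^ k := by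
  have h : {ω | k ≤ S.nAcc N i l ω} =
      ⋂ m ∈ (Finset.range k).map (addLeftEmbedding l), {ω | S.Accepted i m ω} := by
    ext ω; simp [le_nAcc_iff, hk]
  rw [h, Measure.real, hS.iIndep_posVar.meas_biInter
    (fun m _ => S.measurableSet_accepted_comap i m), ENNReal.toReal_prod]
  change ∏ m ∈ _, P.real {ω | S.Accepted i m ω} = _
  simp [hS.measure_accepted]

/-- The law of the number of accepted tokens in a round of drafter `i`. -/
noncomputable def accProb (S : Decoding K V Ω) (P : Measure Ω) (N : ℕ) (i : Fin K) (k : ℕ) : ℝ :=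
  P.real {ω | S.nAcc N i 0 ω = k}

theorem measurableSet_nAcc (S : Decoding K V Ω) (N : ℕ) (i : Fin K) (l k : ℕ) :
    MeasurableSet {ω | S.nAcc N i l ω = k} :=
  S.posSigma_le _ _ (S.measurableSet_nAcc_eq N i l k)

/-- A difference of two geometric tails, the second being zero at k = N. Hence the law of the reward
depends on `ν i` only through its mean. -/
theorem IsStationary.measure_nAcc_eq [IsProbabilityMeasure P] (hS : S.IsStationary P ν)
    {N k : ℕ} (i : Fin K) (l : ℕ) (hk : k ≤ N) :
    P.real {ω | S.nAcc N i l ω = k} =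
      (∫ x, x ∂(ν i)) ^ k - if k < N then (∫ x, x ∂(ν i)) ^ (k + 1) else 0 := by
  have h : {ω | S.nAcc N i l ω = k} = {ω | k ≤ S.nAcc N i l ω} \ {ω | k + 1 ≤ S.nAcc N i l ω} := by
    ext ω; simp only [Set.mem_ofPred_eq, Set.mem_sdiff]; omega
  rw [h, measureReal_sdiff (fun ω hω => by simp only [Set.mem_ofPred_eq] at hω ⊢; omega)
    (S.posSigma_le _ _ (S.measurableSet_le_nAcc N i l (k + 1))), hS.measure_le_nAcc i l hk]
  split_ifs with hkN
  · rw [hS.measure_le_nAcc i l hkN]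
  · have : {ω | k + 1 ≤ S.nAcc N i l ω} = ∅ := by
      ext ω
      have := S.nAcc_le N i l ω
      simp only [Set.mem_ofPred_eq, Set.mem_empty_iff_false, iff_false]; omega
    rw [this, measureReal_empty]

theorem IsStationary.measure_nAcc_eq_accProb [IsProbabilityMeasure P] (hS : S.IsStationary P ν)
    {N k : ℕ} (i : Fin K) (l : ℕ) (hk : k ≤ N) :
    P.real {ω | S.nAcc N i l ω = k} = S.accProb P N i k := by
  rw [accProb, hS.measure_nAcc_eq i l hk, hS.measure_nAcc_eq i 0 hk]

theorem comp_nAcc_eq_sum (S : Decoding K V Ω) (N : ℕ) (i : Fin K) (l : ℕ) (f : ℕ → ℝ) (ω : Ω) :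
    f (S.nAcc N i l ω) = ∑ k ∈ Finset.range (N + 1),
      {ω | S.nAcc N i l ω = k}.indicator (fun _ => f k) ω := by
  rw [Finset.sum_eq_single (S.nAcc N i l ω)]
  · simp
  · intro k _ hk
    exact Set.indicator_of_notMem (fun h => hk h.symm) _
  · intro h
    exact absurd (Finset.mem_range.2 (Nat.lt_succ_of_le (S.nAcc_le N i l ω))) h

theorem integral_comp_nAcc [IsProbabilityMeasure P] (S : Decoding K V Ω)
    {N : ℕ} (i : Fin K) (f : ℕ → ℝ) :
    ∫ ω, f (S.nAcc N i 0 ω) ∂P = ∑ k ∈ Finset.range (N + 1), S.accProb P N i k * f k := by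
  simp_rw [S.comp_nAcc_eq_sum N i 0 f]
  rw [integral_finsetSum]
  · refine Finset.sum_congr rfl fun k _ => ?_
    rw [integral_indicator_const _ (S.measurableSet_nAcc N i 0 k), smul_eq_mul]; rfl
  · intro k _
    exact (integrable_const _).indicator (S.measurableSet_nAcc N i 0 k)

end law

end Decoding

/-! ### Expectations along the random history, which takes finitely many values at each time. -/

theorem pulls_cons {K : ℕ} (x : Fin K × ℕ) (h : History K) (i : Fin K) :
    pulls (x :: h) i = pulls h i + if x.1 = i then 1 else 0 := by
  simp [pulls, List.countP_cons]

theorem pulls_le_length {K : ℕ} (h : History K) (i : Fin K) : pulls h i ≤ h.length :=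
  List.countP_le_length

namespace Decoding

variable {K : ℕ} {V Ω : Type*} [Fintype V] [MeasurableSpace Ω]
variable {S : Decoding K V Ω} {P : Measure Ω} {ν : Fin K → Measure ℝ}

theorem finite_range_hist (S : Decoding K V Ω) (N : ℕ) (π : Policy K) (t : ℕ) :
    (Set.range (S.hist N π t)).Finite := by
  induction t with
  | zero => exact (Set.finite_singleton []).subset (by rintro _ ⟨ω, rfl⟩; rfl)
  | succ t ih =>
    refine (Set.Finite.image2 List.cons
      ((Set.finite_univ (α := Fin K)).prod (Set.finite_Iic N)) ih).subset ?_
    rintro _ ⟨ω, rfl⟩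
    exact ⟨(π (S.hist N π t ω), S.nAcc N (π (S.hist N π t ω)) (tokens (S.hist N π t ω)) ω),
      ⟨Set.mem_univ _, S.nAcc_le N _ _ ω⟩, _, ⟨ω, rfl⟩, rfl⟩

theorem measurableSet_hist (S : Decoding K V Ω) (N : ℕ) (π : Policy K) (t : ℕ) (h : History K) :
    MeasurableSet {ω | S.hist N π t ω = h} :=
  S.posSigma_le _ _ (S.measurableSet_hist_eq N π t h)

theorem comp_hist_eq_sum (S : Decoding K V Ω) (N : ℕ) (π : Policy K) (t : ℕ)
    (F : History K → ℝ) (ω : Ω) :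
    F (S.hist N π t ω) = ∑ h ∈ (S.finite_range_hist N π t).toFinset,
      {ω | S.hist N π t ω = h}.indicator (fun _ => F h) ω := by
  rw [Finset.sum_eq_single (S.hist N π t ω)]
  · simp
  · intro h _ hh
    exact Set.indicator_of_notMem (fun h' => hh h'.symm) _
  · intro h
    exact absurd ((Set.Finite.mem_toFinset _).2 (Set.mem_range_self ω)) h

theorem integrable_comp_hist [IsFiniteMeasure P] (S : Decoding K V Ω) (N : ℕ) (π : Policy K)
    (t : ℕ) (F : History K → ℝ) : Integrable (fun ω => F (S.hist N π t ω)) P := by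
  simp_rw [S.comp_hist_eq_sum N π t F]
  exact integrable_finsetSum _ fun h _ =>
    (integrable_const _).indicator (S.measurableSet_hist N π t h)

theorem integral_comp_hist [IsFiniteMeasure P] (S : Decoding K V Ω) (N : ℕ) (π : Policy K)
    (t : ℕ) (F : History K → ℝ) :
    ∫ ω, F (S.hist N π t ω) ∂P = ∑ h ∈ (S.finite_range_hist N π t).toFinset,
      P.real {ω | S.hist N π t ω = h} * F h := by
  simp_rw [S.comp_hist_eq_sum N π t F]
  rw [integral_finsetSum]
  · refine Finset.sum_congr rfl fun h _ => ?_
    rw [integral_indicator_const _ (S.measurableSet_hist N π t h), smul_eq_mul]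
  · exact fun h _ => (integrable_const _).indicator (S.measurableSet_hist N π t h)

theorem measurableSet_comp_hist (S : Decoding K V Ω) (N : ℕ) (π : Policy K) (t : ℕ)
    (Q : History K → Prop) : MeasurableSet {ω | Q (S.hist N π t ω)} := by
  classical
  have : {ω | Q (S.hist N π t ω)} = ⋃ h ∈ (S.finite_range_hist N π t).toFinset.filter Q,
      {ω | S.hist N π t ω = h} := by
    ext ω
    simp
  rw [this]
  exact Finset.measurableSet_biUnion _ fun h _ => S.measurableSet_hist N π t h

/-- Expectation, given the history `h`, of a quantity that depends on `h` and the number of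
accepted tokens in the next round. -/
noncomputable def stepMean (S : Decoding K V Ω) (P : Measure Ω) (N : ℕ) (π : Policy K)
    (f : History K → ℕ → ℝ) (h : History K) : ℝ :=
  ∑ k ∈ Finset.range (N + 1), S.accProb P N (π h) k * f h k

/-- The number of accepted tokens in round `t` (counted from zero). -/
noncomputable def roundAcc (S : Decoding K V Ω) (N : ℕ) (π : Policy K) (t : ℕ) (ω : Ω) : ℕ :=
  S.nAcc N (π (S.hist N π t ω)) (tokens (S.hist N π t ω)) ω

theorem hist_succ (S : Decoding K V Ω) (N : ℕ) (π : Policy K) (t : ℕ) (ω : Ω) :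
    S.hist N π (t + 1) ω = (π (S.hist N π t ω), S.roundAcc N π t ω) :: S.hist N π t ω := rfl

theorem IsStationary.measure_hist_inter [IsProbabilityMeasure P] (hS : S.IsStationary P ν)
    {N k : ℕ} (π : Policy K) (t : ℕ) (h : History K) (i : Fin K) (hk : k ≤ N) :
    P.real ({ω | S.hist N π t ω = h} ∩ {ω | S.nAcc N i (tokens h) ω = k}) =
      P.real {ω | S.hist N π t ω = h} * S.accProb P N i k := by
  have hd : Disjoint (Set.Iio (tokens h)) (Set.Ico (tokens h) (tokens h + k + 1)) := by
    rw [Set.disjoint_left]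
    intro x hx hx'
    simp only [Set.mem_Iio, Set.mem_Ico] at hx hx'
    omega
  rw [← hS.measure_nAcc_eq_accProb i (tokens h) hk, Measure.real,
    (Indep_iff _ _ P).1 (hS.indep_posSigma hd) _ _ (S.measurableSet_hist_eq N π t h)
      (S.measurableSet_nAcc_eq N i _ k), ENNReal.toReal_mul]
  rfl

/-- The tower property, as a finite sum over histories: the past uses positions below `tokens h`,
the current round those from `tokens h` on. -/
theorem IsStationary.integral_roundAcc [IsProbabilityMeasure P] (hS : S.IsStationary P ν)
    (N : ℕ) (π : Policy K) (t : ℕ) (f : History K → ℕ → ℝ) :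
    ∫ ω, f (S.hist N π t ω) (S.roundAcc N π t ω) ∂P =
      ∫ ω, S.stepMean P N π f (S.hist N π t ω) ∂P := by
  have key : ∀ ω, f (S.hist N π t ω) (S.roundAcc N π t ω) =
      ∑ h ∈ (S.finite_range_hist N π t).toFinset, ∑ k ∈ Finset.range (N + 1),
        ({ω | S.hist N π t ω = h} ∩ {ω | S.nAcc N (π h) (tokens h) ω = k}).indicator
          (fun _ => f h k) ω := by
    intro ω
    rw [Finset.sum_eq_single (S.hist N π t ω)]
    · rw [roundAcc, S.comp_nAcc_eq_sum N (π (S.hist N π t ω)) (tokens (S.hist N π t ω))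
        (f (S.hist N π t ω)) ω]
      refine Finset.sum_congr rfl fun k _ => ?_
      simp only [Set.indicator, Set.mem_inter_iff, Set.mem_ofPred_eq, true_and]
    · intro h _ hh
      exact Finset.sum_eq_zero fun k _ => Set.indicator_of_notMem (fun h' => hh h'.1.symm) _
    · intro h
      exact absurd ((Set.Finite.mem_toFinset _).2 (Set.mem_range_self ω)) h
  have hm : ∀ h k, MeasurableSet
      ({ω | S.hist N π t ω = h} ∩ {ω | S.nAcc N (π h) (tokens h) ω = k}) := fun h k =>
    (S.measurableSet_hist N π t h).inter (S.measurableSet_nAcc N _ _ k)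
  simp_rw [key]
  rw [integral_comp_hist, integral_finsetSum]
  · refine Finset.sum_congr rfl fun h _ => ?_
    rw [integral_finsetSum, stepMean, Finset.mul_sum]
    · refine Finset.sum_congr rfl fun k hk => ?_
      rw [integral_indicator_const _ (hm h k), smul_eq_mul,
        hS.measure_hist_inter π t h _ (Nat.lt_succ_iff.1 (Finset.mem_range.1 hk)), mul_assoc]
    · exact fun k _ => (integrable_const _).indicator (hm h k)
  · exact fun h _ => integrable_finsetSum _ fun k _ => (integrable_const _).indicator (hm h k)

theorem integrable_roundAcc [IsFiniteMeasure P] (S : Decoding K V Ω) (N : ℕ) (π : Policy K)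
    (t : ℕ) (f : History K → ℕ → ℝ) :
    Integrable (fun ω => f (S.hist N π t ω) (S.roundAcc N π t ω)) P :=
  -- The pair (history, acceptances) is read off the next history, which is nonempty, so the default
  -- 0 never occurs.
  S.integrable_comp_hist N π (t + 1) fun h => f h.tail ((h.head?.map Prod.snd).getD 0)

/-! ### Mean and variance of the BE reward. -/

theorem sum_accProb [IsProbabilityMeasure P] (S : Decoding K V Ω) (N : ℕ) (i : Fin K) :
    ∑ k ∈ Finset.range (N + 1), S.accProb P N i k = 1 := by
  have := S.integral_comp_nAcc (P := P) (N := N) i (fun _ => 1)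
  simpa using this.symm

theorem beMean_eq_sum [IsProbabilityMeasure P] (S : Decoding K V Ω) (N : ℕ) (i : Fin K) :
    S.beMean P N i = ∑ k ∈ Finset.range (N + 1), S.accProb P N i k * ((k : ℝ) / N) :=
  S.integral_comp_nAcc (P := P) (N := N) i (fun k => (k : ℝ) / N)

theorem sum_accProb_mul_succ [IsProbabilityMeasure P] (S : Decoding K V Ω) {N : ℕ} (hN : 1 ≤ N)
    (i : Fin K) :
    ∑ k ∈ Finset.range (N + 1), S.accProb P N i k * ((k : ℝ) + 1) = 1 + N * S.beMean P N i := by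
  have h0 : (N : ℝ) ≠ 0 := by positivity
  rw [beMean_eq_sum, Finset.mul_sum]
  simp_rw [mul_add, mul_one]
  rw [Finset.sum_add_distrib, sum_accProb, add_comm]
  congr 1
  refine Finset.sum_congr rfl fun k _ => ?_
  field_simp

theorem beReward_mem_Icc (S : Decoding K V Ω) (N : ℕ) (i : Fin K) (l : ℕ) (ω : Ω) :
    S.beReward N i l ω ∈ Set.Icc (0 : ℝ) 1 := by
  unfold beReward
  exact ⟨by positivity, div_le_one_of_le₀ (by exact_mod_cast S.nAcc_le N i l ω) (by positivity)⟩

theorem measurable_beReward (S : Decoding K V Ω) (N : ℕ) (i : Fin K) (l : ℕ) :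
    Measurable (S.beReward N i l) := by
  have : Measurable (S.nAcc N i l) := measurable_to_countable' fun k => S.measurableSet_nAcc N i l k
  unfold beReward
  exact (measurable_from_top.comp this).div_const _

theorem beVar_eq [IsProbabilityMeasure P] (S : Decoding K V Ω) (N : ℕ) (i : Fin K) :
    S.beVar P N i =
      ∑ k ∈ Finset.range (N + 1), S.accProb P N i k * ((k : ℝ) / N - S.beMean P N i) ^ 2 := by
  rw [beVar, variance_eq_integral (S.measurable_beReward N i 0).aemeasurable]
  exact S.integral_comp_nAcc (P := P) (N := N) i (fun k => ((k : ℝ) / N - S.beMean P N i) ^ 2)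

theorem IsStationary.accProb_congr [IsProbabilityMeasure P] (hS : S.IsStationary P ν)
    {N k : ℕ} {i j : Fin K} (h : ∫ x, x ∂(ν i) = ∫ x, x ∂(ν j)) (hk : k ≤ N) :
    S.accProb P N i k = S.accProb P N j k := by
  rw [accProb, accProb, hS.measure_nAcc_eq i 0 hk, hS.measure_nAcc_eq j 0 hk, h]

theorem IsStationary.beVar_congr [IsProbabilityMeasure P] (hS : S.IsStationary P ν)
    {N : ℕ} {i j : Fin K} (h : ∫ x, x ∂(ν i) = ∫ x, x ∂(ν j)) :
    S.beVar P N i = S.beVar P N j := by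
  have hp : ∀ k ∈ Finset.range (N + 1), S.accProb P N i k = S.accProb P N j k := fun k hk =>
    hS.accProb_congr h (Nat.lt_succ_iff.1 (Finset.mem_range.1 hk))
  have hm : S.beMean P N i = S.beMean P N j := by
    rw [beMean_eq_sum, beMean_eq_sum]
    exact Finset.sum_congr rfl fun k hk => by rw [hp k hk]
  rw [beVar_eq, beVar_eq, hm]
  exact Finset.sum_congr rfl fun k hk => by rw [hp k hk]

/-- Tail-sum formula for E[N_acc]. It shows that the BE mean is strictly increasing in the
acceptance mean and bounded by it. -/
theorem IsStationary.mul_beMean_eq [IsProbabilityMeasure P] (hS : S.IsStationary P ν)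
    {N : ℕ} (hN : 1 ≤ N) (i : Fin K) :
    N * S.beMean P N i = ∑ k ∈ Finset.range N, (∫ x, x ∂(ν i)) ^ (k + 1) := by
  have h0 : (N : ℝ) ≠ 0 := by positivity
  have h1 : ∀ ω, N * S.beReward N i 0 ω = ∑ k ∈ Finset.range N,
      {ω | k + 1 ≤ S.nAcc N i 0 ω}.indicator (fun _ => (1 : ℝ)) ω := by
    intro ω
    have := S.nAcc_le N i 0 ω
    simp only [Set.indicator, Set.mem_ofPred_eq, Finset.sum_boole, beReward]
    rw [mul_div_cancel₀ _ h0]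
    have : (Finset.range N).filter (fun k => k + 1 ≤ S.nAcc N i 0 ω) =
        Finset.range (S.nAcc N i 0 ω) := by
      ext k; simp only [Finset.mem_filter, Finset.mem_range]; omega
    rw [this, Finset.card_range]
  have hm : ∀ k, MeasurableSet {ω | k + 1 ≤ S.nAcc N i 0 ω} := fun k =>
    S.posSigma_le _ _ (S.measurableSet_le_nAcc N i 0 (k + 1))
  rw [beMean, ← integral_const_mul]
  simp_rw [h1]
  rw [integral_finsetSum]
  · refine Finset.sum_congr rfl fun k hk => ?_
    rw [integral_indicator_const _ (hm k), smul_eq_mul, mul_one,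
      hS.measure_le_nAcc i 0 (Finset.mem_range.1 hk)]
  · exact fun k _ => (integrable_const _).indicator (hm k)

theorem IsStationary.beMean_le [IsProbabilityMeasure P] (hS : S.IsStationary P ν)
    {N : ℕ} (hN : 1 ≤ N) (i : Fin K) : S.beMean P N i ≤ ∫ x, x ∂(ν i) := by
  have h0 : (0 : ℝ) < N := by positivity
  obtain ⟨ha, hb⟩ := hS.mean_mem_Icc i
  have : N * S.beMean P N i ≤ N * ∫ x, x ∂(ν i) := by
    rw [hS.mul_beMean_eq hN]
    refine (Finset.sum_le_sum (g := fun _ => ∫ x, x ∂(ν i)) fun k _ => ?_).trans (by simp)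
    exact pow_le_of_le_one ha hb (by omega)
  exact le_of_mul_le_mul_left this h0

theorem IsStationary.beMean_lt [IsProbabilityMeasure P] (hS : S.IsStationary P ν)
    {N : ℕ} (hN : 1 ≤ N) {i j : Fin K} (h : ∫ x, x ∂(ν i) < ∫ x, x ∂(ν j)) :
    S.beMean P N i < S.beMean P N j := by
  have h0 : (0 : ℝ) < N := by positivity
  refine lt_of_mul_lt_mul_left ?_ h0.le
  rw [hS.mul_beMean_eq hN, hS.mul_beMean_eq hN]
  refine Finset.sum_lt_sum_of_nonempty (Finset.nonempty_range_iff.2 (by omega)) fun k _ => ?_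
  exact pow_lt_pow_left₀ h (hS.mean_mem_Icc i).1 (by omega)

theorem beMean_nonneg (S : Decoding K V Ω) (P : Measure Ω) (N : ℕ) (i : Fin K) :
    0 ≤ S.beMean P N i :=
  integral_nonneg fun ω => (S.beReward_mem_Icc N i 0 ω).1

theorem beVar_nonneg (S : Decoding K V Ω) (P : Measure Ω) (N : ℕ) (i : Fin K) :
    0 ≤ S.beVar P N i :=
  variance_nonneg _ _

/-! ### Number of rounds and Wald's identity. -/

theorem length_hist (S : Decoding K V Ω) (N : ℕ) (π : Policy K) (t : ℕ) (ω : Ω) :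
    (S.hist N π t ω).length = t := by
  induction t with
  | zero => rfl
  | succ t ih => rw [hist_succ, List.length_cons, ih]

theorem tokens_hist_succ (S : Decoding K V Ω) (N : ℕ) (π : Policy K) (t : ℕ) (ω : Ω) :
    tokens (S.hist N π (t + 1) ω) = tokens (S.hist N π t ω) + (S.roundAcc N π t ω + 1) := by
  rw [hist_succ, tokens_cons, add_comm]

theorem monotone_tokens_hist (S : Decoding K V Ω) (N : ℕ) (π : Policy K) (ω : Ω) :
    Monotone fun t => tokens (S.hist N π t ω) :=
  monotone_nat_of_le_succ fun t => by simp only [tokens_hist_succ]; omega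

theorem le_tokens_hist (S : Decoding K V Ω) (N : ℕ) (π : Policy K) (t : ℕ) (ω : Ω) :
    t ≤ tokens (S.hist N π t ω) := by
  induction t with
  | zero => exact Nat.zero_le _
  | succ t ih => rw [tokens_hist_succ]; omega

theorem lt_rounds_iff (S : Decoding K V Ω) (N : ℕ) (π : Policy K) (B t : ℕ) (ω : Ω) :
    t < S.rounds N π B ω ↔ tokens (S.hist N π t ω) < B := by
  constructor
  · intro h
    exact not_le.1 (Nat.notMem_of_lt_sInf (s := {t | B ≤ tokens (S.hist N π t ω)}) h)
  · intro h
    by_contra hc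
    have hne : {t | B ≤ tokens (S.hist N π t ω)}.Nonempty := ⟨B, S.le_tokens_hist N π B ω⟩
    have h1 : B ≤ tokens (S.hist N π (S.rounds N π B ω) ω) := Nat.sInf_mem hne
    exact absurd (h1.trans (S.monotone_tokens_hist N π ω (not_lt.1 hc))) (not_le.2 h)

/-- Indicator of the histories in which fewer than `B` tokens have been generated. -/
noncomputable def active {K : ℕ} (B : ℕ) (h : History K) : ℝ := if tokens h < B then 1 else 0

theorem active_nonneg (B : ℕ) (h : History K) : 0 ≤ active B h := by
  unfold active; split_ifs <;> norm_num

theorem active_le_one (B : ℕ) (h : History K) : active B h ≤ 1 := by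
  unfold active; split_ifs <;> norm_num

/-- Each round yields at least one token, so `B` rounds suffice and the stopping time becomes a
finite sum of indicators. -/
theorem rounds_eq_sum (S : Decoding K V Ω) (N : ℕ) (π : Policy K) (B : ℕ) (ω : Ω) :
    (S.rounds N π B ω : ℝ) = ∑ t ∈ Finset.range B, active B (S.hist N π t ω) := by
  have hB : S.rounds N π B ω ≤ B := Nat.sInf_le (S.le_tokens_hist N π B ω)
  simp only [active, ← lt_rounds_iff, Finset.sum_boole]
  have : (Finset.range B).filter (fun t => t < S.rounds N π B ω) =
      Finset.range (S.rounds N π B ω) := by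
    ext t; simp only [Finset.mem_filter, Finset.mem_range]; omega
  rw [this, Finset.card_range]

theorem integrable_rounds [IsFiniteMeasure P] (S : Decoding K V Ω) (N : ℕ) (π : Policy K)
    (B : ℕ) : Integrable (fun ω => (S.rounds N π B ω : ℝ)) P := by
  simp_rw [rounds_eq_sum]
  exact integrable_finsetSum _ fun t _ => S.integrable_comp_hist N π t _

theorem min_le_sum_active_mul (S : Decoding K V Ω) (N : ℕ) (π : Policy K) (B T : ℕ) (ω : Ω) :
    min (tokens (S.hist N π T ω) : ℝ) B ≤ ∑ t ∈ Finset.range T,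
      active B (S.hist N π t ω) * ((S.roundAcc N π t ω : ℝ) + 1) := by
  induction T with
  | zero => simp [hist, tokens]
  | succ T ih =>
    rw [Finset.sum_range_succ, tokens_hist_succ]
    push_cast
    by_cases h : tokens (S.hist N π T ω) < B
    · have h' : (tokens (S.hist N π T ω) : ℝ) < B := by exact_mod_cast h
      rw [min_eq_left h'.le] at ih
      simp only [active, if_pos h] at ih ⊢
      exact (min_le_left _ _).trans (by linarith)
    · have h' : (B : ℝ) ≤ tokens (S.hist N π T ω) := by exact_mod_cast not_lt.1 h
      rw [min_eq_right h'] at ih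
      simp only [active, if_neg h] at ih ⊢
      exact (min_le_right _ _).trans (by linarith)

/-- The last active round starts with at most B - 1 tokens and adds at most N + 1, so the overshoot
is at most N. -/
theorem sum_active_mul_le_min (S : Decoding K V Ω) (N : ℕ) (π : Policy K) (B T : ℕ) (ω : Ω) :
    ∑ t ∈ Finset.range T, active B (S.hist N π t ω) * ((S.roundAcc N π t ω : ℝ) + 1) ≤
      min (tokens (S.hist N π T ω) : ℝ) (B + N) := by
  induction T with
  | zero => simp [hist, tokens]; positivity
  | succ T ih =>
    rw [Finset.sum_range_succ, tokens_hist_succ]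
    push_cast
    have hk : (S.roundAcc N π T ω : ℝ) ≤ N := by exact_mod_cast S.nAcc_le N _ _ ω
    have hk0 : (0 : ℝ) ≤ S.roundAcc N π T ω := by positivity
    obtain ⟨h1, h2⟩ := le_min_iff.1 ih
    by_cases h : tokens (S.hist N π T ω) < B
    · have h' : (tokens (S.hist N π T ω) : ℝ) + 1 ≤ B := by exact_mod_cast h
      simp only [active, if_pos h] at h1 h2 ⊢
      exact le_min (by linarith) (by linarith)
    · simp only [active, if_neg h] at h1 h2 ⊢
      exact le_min (by linarith) (by linarith)

theorem integral_sum_active_mul [IsProbabilityMeasure P] (hS : S.IsStationary P ν)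
    {N : ℕ} (hN : 1 ≤ N) (π : Policy K) (B T : ℕ) :
    ∫ ω, ∑ t ∈ Finset.range T, active B (S.hist N π t ω) * ((S.roundAcc N π t ω : ℝ) + 1) ∂P =
      ∫ ω, ∑ t ∈ Finset.range T,
        active B (S.hist N π t ω) * (1 + N * S.beMean P N (π (S.hist N π t ω))) ∂P := by
  rw [integral_finsetSum, integral_finsetSum]
  · refine Finset.sum_congr rfl fun t _ => ?_
    rw [hS.integral_roundAcc N π t fun h k => active B h * ((k : ℝ) + 1)]
    refine integral_congr_ae (Filter.Eventually.of_forall fun ω => ?_)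
    simp only [stepMean]
    rw [← S.sum_accProb_mul_succ hN, Finset.mul_sum]
    exact Finset.sum_congr rfl fun k _ => by ring
  · exact fun t _ => S.integrable_comp_hist N π t
      fun h => active B h * (1 + N * S.beMean P N (π h))
  · exact fun t _ => S.integrable_roundAcc N π t fun h k => active B h * ((k : ℝ) + 1)

/-- Every policy needs on average at least `B / (1 + N μ_s)` rounds, `s` being the best drafter. -/
theorem IsStationary.le_integral_rounds [IsProbabilityMeasure P] (hS : S.IsStationary P ν)
    {N : ℕ} (hN : 1 ≤ N) (π : Policy K) (B : ℕ) {s : Fin K}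
    (hs : ∀ i, S.beMean P N i ≤ S.beMean P N s) :
    (B : ℝ) ≤ (1 + N * S.beMean P N s) * ∫ ω, (S.rounds N π B ω : ℝ) ∂P := by
  have h1 : (B : ℝ) ≤ ∫ ω, ∑ t ∈ Finset.range B,
      active B (S.hist N π t ω) * ((S.roundAcc N π t ω : ℝ) + 1) ∂P := by
    have : (B : ℝ) = ∫ _, (B : ℝ) ∂P := by simp
    conv_lhs => rw [this]
    refine integral_mono (integrable_const _) (integrable_finsetSum _ fun t _ =>
      S.integrable_roundAcc N π t fun h k => active B h * ((k : ℝ) + 1)) fun ω => ?_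
    refine le_trans (le_min ?_ le_rfl) (S.min_le_sum_active_mul N π B B ω)
    exact Nat.cast_le.2 (S.le_tokens_hist N π B ω)
  refine h1.trans ?_
  rw [integral_sum_active_mul hS hN, ← integral_const_mul]
  simp_rw [rounds_eq_sum, Finset.mul_sum]
  refine integral_mono (integrable_finsetSum _ fun t _ => S.integrable_comp_hist N π t
      fun h => active B h * (1 + N * S.beMean P N (π h)))
    (integrable_finsetSum _ fun t _ => S.integrable_comp_hist N π t
      fun h => (1 + N * S.beMean P N s) * active B h) fun ω => ?_
  refine Finset.sum_le_sum fun t _ => ?_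
  rw [mul_comm]
  exact mul_le_mul_of_nonneg_right (by gcongr; exact hs _) (active_nonneg _ _)

theorem pulls_hist_succ (S : Decoding K V Ω) (N : ℕ) (π : Policy K) (t : ℕ) (ω : Ω) (i : Fin K) :
    pulls (S.hist N π (t + 1) ω) i =
      pulls (S.hist N π t ω) i + if π (S.hist N π t ω) = i then 1 else 0 := by
  rw [hist_succ, pulls_cons]

theorem pulls_hist_eq_sum (S : Decoding K V Ω) (N : ℕ) (π : Policy K) (T : ℕ) (ω : Ω)
    (i : Fin K) :
    (pulls (S.hist N π T ω) i : ℝ) =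
      ∑ t ∈ Finset.range T, if π (S.hist N π t ω) = i then (1 : ℝ) else 0 := by
  induction T with
  | zero => simp [hist, pulls]
  | succ T ih => rw [pulls_hist_succ, Finset.sum_range_succ, ← ih]; push_cast; rfl

/-- Regret decomposition of the expected number of rounds over the suboptimal drafters. -/
theorem IsStationary.integral_rounds_le [IsProbabilityMeasure P] (hS : S.IsStationary P ν)
    {N : ℕ} (hN : 1 ≤ N) (π : Policy K) (B : ℕ) {s : Fin K}
    (hs : ∀ i, S.beMean P N i ≤ S.beMean P N s) :
    (1 + N * S.beMean P N s) * ∫ ω, (S.rounds N π B ω : ℝ) ∂P ≤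
      B + N + ∑ i, N * S.beGap P N s i * ∫ ω, (pulls (S.hist N π B ω) i : ℝ) ∂P := by
  have hint := fun t => S.integrable_comp_hist (P := P) N π t
    fun h => active B h * (1 + N * S.beMean P N (π h))
  have h1 : ∫ ω, ∑ t ∈ Finset.range B,
      active B (S.hist N π t ω) * (1 + N * S.beMean P N (π (S.hist N π t ω))) ∂P ≤ B + N := by
    rw [← integral_sum_active_mul hS hN]
    have : (B : ℝ) + N = ∫ _, ((B : ℝ) + N) ∂P := by simp
    conv_rhs => rw [this]
    refine integral_mono (integrable_finsetSum _ fun t _ =>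
      S.integrable_roundAcc N π t fun h k => active B h * ((k : ℝ) + 1)) (integrable_const _)
      fun ω => (S.sum_active_mul_le_min N π B B ω).trans (min_le_right _ _)
  have hp := fun i => S.integrable_comp_hist (P := P) N π B fun h => (pulls h i : ℝ)
  have h2 : (1 + N * S.beMean P N s) * ∫ ω, (S.rounds N π B ω : ℝ) ∂P ≤
      ∫ ω, ((∑ t ∈ Finset.range B,
        active B (S.hist N π t ω) * (1 + N * S.beMean P N (π (S.hist N π t ω)))) +
        ∑ i, N * S.beGap P N s i * (pulls (S.hist N π B ω) i : ℝ)) ∂P := by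
    rw [← integral_const_mul]
    refine integral_mono ((S.integrable_rounds N π B).const_mul _)
      ((integrable_finsetSum _ fun t _ => hint t).add
        (integrable_finsetSum _ fun i _ => (hp i).const_mul _)) fun ω => ?_
    simp_rw [rounds_eq_sum, pulls_hist_eq_sum, Finset.mul_sum]
    rw [Finset.sum_comm, ← Finset.sum_add_distrib]
    refine Finset.sum_le_sum fun t _ => ?_
    simp only [mul_ite, mul_one, mul_zero, Finset.sum_ite_eq, Finset.mem_univ, if_true]
    -- For the drafter i played, 1 + N μ_s = (1 + N μ_i) + N Δ_i. Dropping `active` from the gap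
    -- term only adds pulls made after `B` tokens are reached.
    have hg : 0 ≤ N * S.beGap P N s (π (S.hist N π t ω)) :=
      mul_nonneg (by positivity) (sub_nonneg.2 (hs _))
    have := mul_le_mul_of_nonneg_right (active_le_one B (S.hist N π t ω)) hg
    unfold beGap at this ⊢
    linarith
  rw [integral_add (integrable_finsetSum _ fun t _ => hint t)
    (integrable_finsetSum _ fun i _ => (hp i).const_mul _),
    integral_finsetSum _ fun i _ => (hp i).const_mul _] at h2
  simp_rw [integral_const_mul] at h2
  linarith

end Decoding

/-! ### Concentration of the rewards and the number of suboptimal pulls. -/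

/-- Sum of the rewards collected from drafter `i`. -/
noncomputable def rewardSum {K : ℕ} (N : ℕ) (h : History K) (i : Fin K) : ℝ :=
  ((h.filter fun x => x.1 = i).map fun x => (x.2 : ℝ) / N).sum

theorem rewardSum_cons {K : ℕ} (N : ℕ) (x : Fin K × ℕ) (h : History K) (i : Fin K) :
    rewardSum N (x :: h) i = rewardSum N h i + if x.1 = i then (x.2 : ℝ) / N else 0 := by
  unfold rewardSum
  by_cases hx : x.1 = i <;> simp [hx, add_comm]

/-- The exponential supermartingale of Hoeffding's inequality for the rewards of drafter `i`. -/
noncomputable def expDev {K : ℕ} (N : ℕ) (i : Fin K) (μ a : ℝ) (h : History K) : ℝ :=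
  Real.exp (a * (rewardSum N h i - pulls h i * μ) - a ^ 2 / 8 * pulls h i)

/-- The rewards of drafter `i` deviate from their mean `μ` in the direction `σ = ±1` by more than
the exploration bonus. -/
def Deviates {K : ℕ} (N : ℕ) (β : ℝ) (i : Fin K) (μ σ : ℝ) (h : History K) : Prop :=
  1 ≤ pulls h i ∧ pulls h i * (β * Real.sqrt (2 * Real.log h.length / pulls h i)) ≤
    σ * (rewardSum N h i - pulls h i * μ)

/-- If drafter `i` maximizes the index although it was used often enough, then the rewards of `i`
or of the best drafter deviate from their means. -/
theorem deviates_of_ucbIndex_le {K N : ℕ} {β u μi μs : ℝ} {h : History K} {i s : Fin K}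
    (hlen : 1 ≤ h.length) (hΔ : μi < μs) (hi : 1 ≤ pulls h i) (hs : 1 ≤ pulls h s)
    (hidx : ucbIndex N β h s ≤ ucbIndex N β h i)
    (hu : 8 * β ^ 2 * Real.log h.length / (μs - μi) ^ 2 ≤ u) (hpu : u < pulls h i) :
    Deviates N β i μi 1 h ∨ Deviates N β s μs (-1) h := by
  by_contra! hc
  obtain ⟨hc1, hc2⟩ := hc
  have hpi : (0 : ℝ) < pulls h i := by exact_mod_cast hi
  have hps : (0 : ℝ) < pulls h s := by exact_mod_cast hs
  have h1 := not_le.1 fun hh => hc1 ⟨hi, hh⟩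
  have h2 := not_le.1 fun hh => hc2 ⟨hs, hh⟩
  have hlog : 0 ≤ Real.log h.length := Real.log_nonneg (by exact_mod_cast hlen)
  set bi := β * Real.sqrt (2 * Real.log h.length / pulls h i) with hbi
  set bs := β * Real.sqrt (2 * Real.log h.length / pulls h s) with hbs
  have hΔ' : 0 < μs - μi := sub_pos.2 hΔ
  -- Without deviations, μs < index of s ≤ index of i < μi + 2 `bi`, while the number of pulls of i
  -- forces 2 `bi` ≤ μs - μi.
  have e1 : rewardSum N h i / pulls h i < μi + bi := by
    rw [div_lt_iff₀ hpi]; linarith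
  have e2 : μs - bs < rewardSum N h s / pulls h s := by
    rw [lt_div_iff₀ hps]; linarith
  have hidx' : rewardSum N h s / pulls h s + bs ≤ rewardSum N h i / pulls h i + bi := hidx
  have hb : 2 * bi ≤ μs - μi := by
    refine abs_le_of_sq_le_sq' ?_ hΔ'.le |>.2
    have hsq : (2 * bi) ^ 2 = 8 * β ^ 2 * Real.log h.length / pulls h i := by
      rw [hbi, mul_pow, mul_pow, Real.sq_sqrt (by positivity)]; ring
    rw [hsq, div_le_iff₀ hpi]
    have := (div_le_iff₀ (by positivity)).1 (hu.trans hpu.le)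
    linarith
  linarith

namespace Decoding

variable {K : ℕ} {V Ω : Type*} [Fintype V] [MeasurableSpace Ω]
variable {S : Decoding K V Ω} {P : Measure Ω} {ν : Fin K → Measure ℝ}

theorem sum_accProb_exp_le [IsProbabilityMeasure P] (S : Decoding K V Ω) (N : ℕ) (i : Fin K)
    (a : ℝ) :
    ∑ k ∈ Finset.range (N + 1),
      S.accProb P N i k * Real.exp (a * ((k : ℝ) / N - S.beMean P N i)) ≤
        Real.exp (a ^ 2 / 8) := by
  have h := (hasSubgaussianMGF_of_mem_Icc (μ := P) (S.measurable_beReward N i 0).aemeasurable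
    (Filter.Eventually.of_forall (S.beReward_mem_Icc N i 0))).mgf_le a
  have h1 := S.integral_comp_nAcc (P := P) (N := N) i
    (fun k => Real.exp (a * ((k : ℝ) / N - S.beMean P N i)))
  rw [← h1]
  refine (le_of_eq ?_).trans (h.trans_eq ?_)
  · rfl
  · congr 1
    push_cast
    norm_num
    ring

/-- By Hoeffding's lemma a reward in [0,1] contributes at most exp(a²/8), which the compensator
cancels; a round of another drafter changes nothing. -/
theorem stepMean_expDev_le [IsProbabilityMeasure P] (S : Decoding K V Ω) (N : ℕ) (π : Policy K)
    (i : Fin K) (a : ℝ) (h : History K) :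
    S.stepMean P N π (fun h k => expDev N i (S.beMean P N i) a ((π h, k) :: h)) h ≤
      expDev N i (S.beMean P N i) a h := by
  unfold stepMean expDev
  by_cases hi : π h = i
  · have : ∀ k : ℕ, Real.exp (a * (rewardSum N ((π h, k) :: h) i -
        pulls ((π h, k) :: h) i * S.beMean P N i) - a ^ 2 / 8 * pulls ((π h, k) :: h) i) =
        Real.exp (a * ((k : ℝ) / N - S.beMean P N i)) * (Real.exp (a * (rewardSum N h i -
          pulls h i * S.beMean P N i) - a ^ 2 / 8 * pulls h i) * Real.exp (-(a ^ 2 / 8))) := by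
      intro k
      rw [rewardSum_cons, pulls_cons, ← Real.exp_add, ← Real.exp_add]
      simp only [hi, if_true]
      push_cast
      ring_nf
    simp_rw [this, ← mul_assoc]
    rw [← Finset.sum_mul, ← Finset.sum_mul, hi]
    have h2 := S.sum_accProb_exp_le (P := P) N i a
    calc _ ≤ Real.exp (a ^ 2 / 8) * Real.exp (a * (rewardSum N h i -
          pulls h i * S.beMean P N i) - a ^ 2 / 8 * pulls h i) * Real.exp (-(a ^ 2 / 8)) := by
            gcongr
      _ = _ := by rw [← Real.exp_add, ← Real.exp_add]; ring_nf
  · simp_rw [rewardSum_cons, pulls_cons, if_neg hi, add_zero]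
    rw [← Finset.sum_mul, sum_accProb, one_mul]

theorem IsStationary.integral_expDev_le_one [IsProbabilityMeasure P] (hS : S.IsStationary P ν)
    (N : ℕ) (π : Policy K) (i : Fin K) (a : ℝ) (t : ℕ) :
    ∫ ω, expDev N i (S.beMean P N i) a (S.hist N π t ω) ∂P ≤ 1 := by
  induction t with
  | zero => simp [hist, expDev, rewardSum, pulls]
  | succ t ih =>
    refine le_trans ?_ ih
    simp_rw [hist_succ]
    rw [hS.integral_roundAcc N π t
      fun h k => expDev N i (S.beMean P N i) a ((π h, k) :: h)]
    exact integral_mono (S.integrable_comp_hist N π t _) (S.integrable_comp_hist N π t _)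
      fun ω => S.stepMean_expDev_le N π i a _

theorem IsStationary.measure_mul_le_one [IsProbabilityMeasure P] (hS : S.IsStationary P ν)
    (N : ℕ) (π : Policy K) (i : Fin K) (a c : ℝ) (t : ℕ) (Q : History K → Prop)
    (hQ : ∀ h, h.length = t → Q h → c ≤ expDev N i (S.beMean P N i) a h) :
    P.real {ω | Q (S.hist N π t ω)} * c ≤ 1 := by
  refine le_trans ?_ (hS.integral_expDev_le_one N π i a t)
  rw [← smul_eq_mul, ← integral_indicator_const _ (S.measurableSet_comp_hist N π t Q)]
  refine integral_mono ((integrable_const _).indicator (S.measurableSet_comp_hist N π t Q))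
    (S.integrable_comp_hist N π t _) fun ω => ?_
  by_cases hω : Q (S.hist N π t ω)
  · rw [Set.indicator_of_mem (by exact hω)]
    exact hQ _ (S.length_hist N π t ω) hω
  · rw [Set.indicator_of_notMem (by exact hω)]
    exact (Real.exp_pos _).le

theorem IsStationary.measure_deviates_pulls_le [IsProbabilityMeasure P] (hS : S.IsStationary P ν)
    (N : ℕ) (π : Policy K) (i : Fin K) {β σ : ℝ} (hβ : 1 ≤ β) (hσ : σ ^ 2 = 1) {t n : ℕ}
    (ht : 1 ≤ t) (hn : 1 ≤ n) :
    P.real {ω | pulls (S.hist N π t ω) i = n ∧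
      Deviates N β i (S.beMean P N i) σ (S.hist N π t ω)} ≤ ((t : ℝ) ^ 4)⁻¹ := by
  have ht0 : (0 : ℝ) < t := by exact_mod_cast ht
  have hn0 : (0 : ℝ) < n := by exact_mod_cast hn
  have hlog : 0 ≤ Real.log t := Real.log_nonneg (by exact_mod_cast ht)
  set ε := β * Real.sqrt (2 * Real.log t / n) with hε
  rw [← one_div, le_div_iff₀ (by positivity)]
  -- Optimal Chernoff parameter for a deviation n ε: the exponent is 4nε² - 2nε² = 2nε² = 4β² ln t ≥
  -- 4 ln t. It depends on n, which is why the number of pulls is fixed here.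
  refine hS.measure_mul_le_one N π i (4 * ε * σ) _ t
    (fun h => pulls h i = n ∧ Deviates N β i (S.beMean P N i) σ h) ?_
  rintro h hlen ⟨hp, -, hdev⟩
  rw [hp, hlen, ← hε] at hdev
  have hε2 : ε ^ 2 * n = β ^ 2 * (2 * Real.log t) := by
    rw [hε, mul_pow, Real.sq_sqrt (by positivity)]; field_simp
  have hε0 : 0 ≤ ε := by positivity
  have e4 : (t : ℝ) ^ 4 = Real.exp (4 * Real.log t) := by
    rw [← Real.exp_log (show (0 : ℝ) < (t : ℝ) ^ 4 by positivity), Real.log_pow]; norm_num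
  rw [e4]
  unfold expDev
  rw [Real.exp_le_exp, hp]
  have h1 : 4 * ε * (n * ε) ≤ 4 * ε * (σ * (rewardSum N h i - n * S.beMean P N i)) := by
    gcongr
  have h2 : (4 * ε * σ) ^ 2 / 8 * n = 2 * (ε ^ 2 * n) := by
    rw [mul_pow, hσ]; ring
  have h3 : Real.log t ≤ β ^ 2 * Real.log t := le_mul_of_one_le_left hlog (by nlinarith)
  rw [h2]
  nlinarith

/-- Union bound over the possible numbers of pulls 1, …, t: t · t⁻⁴ ≤ t⁻². -/
theorem IsStationary.measure_deviates_le [IsProbabilityMeasure P] (hS : S.IsStationary P ν)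
    (N : ℕ) (π : Policy K) (i : Fin K) {β σ : ℝ} (hβ : 1 ≤ β) (hσ : σ ^ 2 = 1) {t : ℕ}
    (ht : 1 ≤ t) :
    P.real {ω | Deviates N β i (S.beMean P N i) σ (S.hist N π t ω)} ≤ ((t : ℝ) ^ 2)⁻¹ := by
  have hsub : {ω | Deviates N β i (S.beMean P N i) σ (S.hist N π t ω)} ⊆
      ⋃ n ∈ Finset.Icc 1 t, {ω | pulls (S.hist N π t ω) i = n ∧
        Deviates N β i (S.beMean P N i) σ (S.hist N π t ω)} := by
    intro ω hω
    refine Set.mem_biUnion (x := pulls (S.hist N π t ω) i) ?_ ⟨rfl, hω⟩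
    have := pulls_le_length (S.hist N π t ω) i
    rw [length_hist] at this
    exact Finset.mem_coe.2 (Finset.mem_Icc.2 ⟨hω.1, this⟩)
  refine (measureReal_mono hsub (measure_ne_top _ _)).trans
    ((measureReal_biUnion_finset_le _ _).trans ((Finset.sum_le_sum fun n hn =>
      hS.measure_deviates_pulls_le N π i hβ hσ ht (Finset.mem_Icc.1 hn).1).trans ?_))
  have ht1 : (1 : ℝ) ≤ t := by exact_mod_cast ht
  have ht0 : (0 : ℝ) < t := by linarith
  rw [Finset.sum_const, Nat.card_Icc, nsmul_eq_mul, Nat.add_sub_cancel]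
  rw [← div_eq_mul_inv, div_le_iff₀ (by positivity), inv_mul_eq_div, le_div_iff₀ (by positivity)]
  have : (t : ℝ) * t ^ 2 = t ^ 3 := by ring
  rw [this]
  exact pow_le_pow_right₀ ht1 (by norm_num)

/-- Initialization: after round `t`, all drafters with index below `min t K` have been used. -/
theorem one_le_pulls_hist {N : ℕ} {β : ℝ} {π : Policy K} (hπ : IsMetaSDUCB N β π)
    (S : Decoding K V Ω) (t : ℕ) (ω : Ω) (j : Fin K) (hj : (j : ℕ) < t) :
    1 ≤ pulls (S.hist N π t ω) j := by
  induction t with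
  | zero => omega
  | succ t ih =>
    rw [pulls_hist_succ]
    rcases Nat.lt_succ_iff_lt_or_eq.1 hj with h | h
    · exact (ih h).trans (Nat.le_add_right _ _)
    · have hlen : (S.hist N π t ω).length < K := by rw [length_hist, ← h]; exact j.2
      have : π (S.hist N π t ω) = j := by
        rw [hπ.1 _ hlen]; ext; simp only [length_hist, h]
      rw [if_pos this]; omega

/-- After initialization, a pull of `i` either happens while its count is below the threshold, or is
charged to a deviation at that round. The threshold uses ln B, which dominates ln r for all rounds r
≤ B. -/
theorem pulls_hist_le {N : ℕ} {β : ℝ} {π : Policy K} (hπ : IsMetaSDUCB N β π)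
    (S : Decoding K V Ω) {μi μs : ℝ} (hΔ : μi < μs) {i s : Fin K} {B : ℕ} (t : ℕ)
    (htB : t ≤ B) (ω : Ω) :
    (pulls (S.hist N π t ω) i : ℝ) ≤ 8 * β ^ 2 * Real.log B / (μs - μi) ^ 2 + K + 1 +
      ∑ r ∈ Finset.Ioo 0 t, (({ω | Deviates N β i μi 1 (S.hist N π r ω)}.indicator 1 ω : ℝ) +
        {ω | Deviates N β s μs (-1) (S.hist N π r ω)}.indicator 1 ω) := by
  have hu0 : 0 ≤ 8 * β ^ 2 * Real.log B / (μs - μi) ^ 2 := by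
    have := Real.log_natCast_nonneg B
    positivity
  have hind : ∀ A : Set Ω, (0 : ℝ) ≤ A.indicator 1 ω := fun A =>
    Set.indicator_nonneg (fun _ _ => zero_le_one) ω
  have hsum : ∀ t, (0 : ℝ) ≤ ∑ r ∈ Finset.Ioo 0 t,
      (({ω | Deviates N β i μi 1 (S.hist N π r ω)}.indicator 1 ω : ℝ) +
        {ω | Deviates N β s μs (-1) (S.hist N π r ω)}.indicator 1 ω) := fun t =>
    Finset.sum_nonneg fun r _ => add_nonneg (hind _) (hind _)
  induction t with
  | zero =>
    have := hsum 0
    simp only [hist, pulls, List.countP_nil, Nat.cast_zero]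
    positivity
  | succ t ih =>
    by_cases htK : t < K
    · have h1 := pulls_le_length (S.hist N π (t + 1) ω) i
      rw [length_hist] at h1
      have h2 : (pulls (S.hist N π (t + 1) ω) i : ℝ) ≤ K := by exact_mod_cast h1.trans htK
      linarith [hsum (t + 1)]
    · have hK : 0 < K := i.pos
      have hIoo : Finset.Ioo 0 (t + 1) = insert t (Finset.Ioo 0 t) := by
        ext r; simp only [Finset.mem_Ioo, Finset.mem_insert]; omega
      have ih := ih (by omega)
      rw [hIoo, Finset.sum_insert (by simp), pulls_hist_succ]
      by_cases hi : π (S.hist N π t ω) = i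
      · rw [if_pos hi]
        push_cast
        by_cases hu : (pulls (S.hist N π t ω) i : ℝ) ≤ 8 * β ^ 2 * Real.log B / (μs - μi) ^ 2
        · have h1 := hind {ω | Deviates N β i μi 1 (S.hist N π t ω)}
          have h2 := hind {ω | Deviates N β s μs (-1) (S.hist N π t ω)}
          have h3 : (0 : ℝ) ≤ K := by positivity
          linarith [hsum t]
        · have hlen := S.length_hist N π t ω
          have hidx := hπ.2 (S.hist N π t ω) (by omega) s
          rw [hi] at hidx
          have hlogle : Real.log t ≤ Real.log B :=
            Real.log_le_log (by exact_mod_cast (by omega : 0 < t)) (by exact_mod_cast (by omega))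
          rcases deviates_of_ucbIndex_le (N := N) (h := S.hist N π t ω) (by omega) hΔ
            (one_le_pulls_hist hπ S t ω i (by omega)) (one_le_pulls_hist hπ S t ω s (by omega))
            hidx (by rw [hlen]; gcongr) (not_le.1 hu) with hd | hd
          · have h1 : ({ω | Deviates N β i μi 1 (S.hist N π t ω)}.indicator 1 ω : ℝ) = 1 :=
              Set.indicator_of_mem (by exact hd) _
            have h2 := hind {ω | Deviates N β s μs (-1) (S.hist N π t ω)}
            linarith
          · have h1 : ({ω | Deviates N β s μs (-1) (S.hist N π t ω)}.indicator 1 ω : ℝ) = 1 :=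
              Set.indicator_of_mem (by exact hd) _
            have h2 := hind {ω | Deviates N β i μi 1 (S.hist N π t ω)}
            linarith
      · rw [if_neg hi, add_zero]
        linarith [hind {ω | Deviates N β i μi 1 (S.hist N π t ω)},
          hind {ω | Deviates N β s μs (-1) (S.hist N π t ω)}]

theorem IsStationary.integral_pulls_le [IsProbabilityMeasure P] (hS : S.IsStationary P ν)
    {N : ℕ} {β : ℝ} {π : Policy K} (hπ : IsMetaSDUCB N β π) (hβ : 1 ≤ β) {i s : Fin K}
    (hΔ : 0 < S.beGap P N s i) (B : ℕ) :
    ∫ ω, (pulls (S.hist N π B ω) i : ℝ) ∂P ≤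
      8 * β ^ 2 * Real.log B / S.beGap P N s i ^ 2 + K + 5 := by
  have hm : ∀ j σ r, Integrable ({ω | Deviates N β j (S.beMean P N j) σ
      (S.hist N π r ω)}.indicator (1 : Ω → ℝ)) P := fun j σ r =>
    (integrable_const (1 : ℝ)).indicator (S.measurableSet_comp_hist N π r _)
  have hi : ∀ j σ r, ∫ ω, {ω | Deviates N β j (S.beMean P N j) σ
      (S.hist N π r ω)}.indicator (1 : Ω → ℝ) ω ∂P = P.real {ω | Deviates N β j (S.beMean P N j) σ
      (S.hist N π r ω)} := fun j σ r =>
    integral_indicator_one (S.measurableSet_comp_hist N π r _)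
  have hint : Integrable (fun ω => ∑ r ∈ Finset.Ioo 0 B,
      (({ω | Deviates N β i (S.beMean P N i) 1 (S.hist N π r ω)}.indicator 1 ω : ℝ) +
        {ω | Deviates N β s (S.beMean P N s) (-1) (S.hist N π r ω)}.indicator 1 ω)) P :=
    integrable_finsetSum _ fun r _ => (hm _ _ _).add (hm _ _ _)
  refine (integral_mono (S.integrable_comp_hist N π B fun h => (pulls h i : ℝ))
    ((integrable_const _).add hint) fun ω => pulls_hist_le (s := s) hπ S
      (sub_pos.1 hΔ) B le_rfl ω).trans ?_
  rw [integral_add' (integrable_const _) hint, integral_finsetSum]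
  rotate_left
  · exact fun r _ => (hm _ _ _).add (hm _ _ _)
  have hsum : ∑ r ∈ Finset.Ioo 0 B, ∫ ω,
      (({ω | Deviates N β i (S.beMean P N i) 1 (S.hist N π r ω)}.indicator 1 ω : ℝ) +
        {ω | Deviates N β s (S.beMean P N s) (-1) (S.hist N π r ω)}.indicator 1 ω) ∂P ≤
      ∑ r ∈ Finset.Ioo 0 B, 2 * ((r : ℝ) ^ 2)⁻¹ := by
    refine Finset.sum_le_sum fun r hr => ?_
    have hr1 : 1 ≤ r := (Finset.mem_Ioo.1 hr).1
    rw [integral_add (hm _ _ _) (hm _ _ _), hi, hi]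
    linarith [hS.measure_deviates_le N π i hβ (σ := 1) (by norm_num) hr1,
      hS.measure_deviates_le N π s hβ (σ := -1) (by norm_num) hr1]
  -- The two deviation events cost at most 2 ∑ r⁻² ≤ 4 in total, which turns K + 1 into K + 5.
  have hsq := sum_Ioo_inv_sq_le (α := ℝ) 0 B
  rw [← Finset.mul_sum] at hsum
  simp only [integral_const, probReal_univ, one_smul]
  unfold beGap
  norm_num at hsq
  linarith

/-! ### Assembly of the regret bound. -/

theorem ucbRegret_le [IsProbabilityMeasure P] (hS : S.IsStationary P ν)
    {N : ℕ} (hN : 1 ≤ N) {β : ℝ} {π : Policy K} (hπ : IsMetaSDUCB N β π) (hβ : 1 ≤ β) {s : Fin K}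
    (hΔ : ∀ i ≠ s, 0 < S.beGap P N s i) (B : ℕ) :
    S.ucbRegret P N π B ≤ (∑ i ∈ Finset.univ.erase s,
      (8 * β ^ 2 * Real.log B / S.beGap P N s i ^ 2 + K + 5)) + K + N := by
  have hle : ∀ i, S.beMean P N i ≤ S.beMean P N s := fun i => by
    rcases eq_or_ne i s with rfl | hi
    · exact le_rfl
    · exact (sub_pos.1 (hΔ i hi)).le
  set M := 1 + N * S.beMean P N s with hM
  have hNμ : 0 ≤ N * S.beMean P N s := mul_nonneg (by positivity) (S.beMean_nonneg P N s)
  have hM1 : 1 ≤ M := by linarith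
  have hM0 : 0 < M := by linarith
  have : Nonempty (Policy K) := ⟨π⟩
  have hopt : B / M ≤ S.optimalRounds P N B :=
    le_ciInf fun π' => (div_le_iff₀' hM0).2 (hS.le_integral_rounds hN π' B hle)
  have hucb : ∫ ω, (S.ucbRounds N π B ω : ℝ) ∂P ≤ K + ∫ ω, (S.rounds N π B ω : ℝ) ∂P := by
    have hK : (K : ℝ) + ∫ ω, (S.rounds N π B ω : ℝ) ∂P =
        ∫ ω, ((K : ℝ) + S.rounds N π B ω) ∂P := by
      rw [integral_add (integrable_const _) (S.integrable_rounds N π B)]; simp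
    rw [hK]
    refine integral_mono_of_nonneg (Filter.Eventually.of_forall fun ω => by positivity)
      ((integrable_const _).add (S.integrable_rounds N π B))
      (Filter.Eventually.of_forall fun ω => ?_)
    have : S.ucbRounds N π B ω ≤ K + S.rounds N π B ω := max_le (by omega) (by omega)
    dsimp only
    exact_mod_cast this
  have hdec := hS.integral_rounds_le hN π B hle
  have hpull0 : ∀ i, 0 ≤ ∫ ω, (pulls (S.hist N π B ω) i : ℝ) ∂P := fun i =>
    integral_nonneg fun ω => by positivity
  have hsum : ∑ i, N * S.beGap P N s i * ∫ ω, (pulls (S.hist N π B ω) i : ℝ) ∂P ≤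
      M * ∑ i ∈ Finset.univ.erase s, (8 * β ^ 2 * Real.log B / S.beGap P N s i ^ 2 + K + 5) := by
    rw [← Finset.add_sum_erase _ _ (Finset.mem_univ s), Finset.mul_sum]
    have : S.beGap P N s s = 0 := sub_self _
    rw [this, mul_zero, zero_mul, zero_add]
    refine Finset.sum_le_sum fun i hi => ?_
    have hg := hΔ i (Finset.ne_of_mem_erase hi)
    -- One suboptimal round loses at most M expected tokens, hence costs at most one extra round
    -- after division by M.
    have hgM : N * S.beGap P N s i ≤ M := by
      have : 0 ≤ N * S.beMean P N i := mul_nonneg (by positivity) (S.beMean_nonneg P N i)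
      unfold beGap
      linarith
    exact mul_le_mul hgM (hS.integral_pulls_le hπ hβ hg B) (hpull0 i) hM0.le
  have hR : ∫ ω, (S.rounds N π B ω : ℝ) ∂P ≤ B / M + N + ∑ i ∈ Finset.univ.erase s,
      (8 * β ^ 2 * Real.log B / S.beGap P N s i ^ 2 + K + 5) := by
    refine le_of_mul_le_mul_left ?_ hM0
    have h1 : M * (B / M) = B := mul_div_cancel₀ _ hM0.ne'
    have h2 : (N : ℝ) ≤ M * N := le_mul_of_one_le_left (by positivity) hM1
    rw [mul_add, mul_add, h1]
    linarith
  unfold ucbRegret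
  linarith

end Decoding

end MetaSD

theorem mainTheorem5 (K N : ℕ) (hN : 1 ≤ N) (αs : ℝ) :
    ∃ C > (0 : ℝ), ∃ C' > (0 : ℝ),
      ∀ (Ω V : Type*) [MeasurableSpace Ω] [Fintype V] (P : MeasureTheory.Measure Ω)
        [MeasureTheory.IsProbabilityMeasure P]
        (S : MetaSD.Decoding K V Ω) (ν : Fin K → MeasureTheory.Measure ℝ),
        S.IsStationary P ν →
        ∀ s : Fin K, (∫ x, x ∂(ν s)) = αs →
          (∀ i, (∫ x, x ∂(ν i)) ≤ ∫ x, x ∂(ν s)) →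
          (∀ i, i ≠ s → S.beVar P N i < S.beVar P N s) →
          ∀ β : ℝ, 1 ≤ β → β ≤ Real.sqrt (4 * S.beVar P N s + 2) →
          ∀ π : MetaSD.Policy K, MetaSD.IsMetaSDUCB N β π →
          ∀ B : ℕ, 1 ≤ B →
            S.ucbRegret P N π B ≤
              (∑ i ∈ Finset.univ.erase s,
                (32 * S.beVar P N s + 16) / (S.beGap P N s i) ^ 2 *
                  (Real.log B +
                    Real.log (Real.log
                      (∑ j ∈ Finset.univ.erase s, 1 / (S.beGap P N s j) ^ 2)) + C')) + C := by
  -- In C: K + 5 per drafter, K for the forced initialization, N for the overshoot. C' offsets the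
  -- lower bound ln ln(1/αs²) of the double logarithm.
  refine ⟨K * (K + 5) + K + N + 1, by positivity, |Real.log (Real.log (1 / αs ^ 2))| + 1,
    by positivity, ?_⟩
  intro Ω V _ _ P _ S ν hS s hαs hmax hvar β hβ1 hβ π hπ B hB
  -- Equal acceptance means would give equal reward laws, hence equal variances.
  have hlt : ∀ i ≠ s, ∫ x, x ∂(ν i) < ∫ x, x ∂(ν s) := fun i hi =>
    (hmax i).lt_of_ne fun h => (hvar i hi).ne (hS.beVar_congr h)
  have hΔ : ∀ i ≠ s, 0 < S.beGap P N s i := fun i hi => sub_pos.2 (hS.beMean_lt hN (hlt i hi))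
  refine (MetaSD.Decoding.ucbRegret_le hS hN hπ hβ1 hΔ B).trans ?_
  have hV := S.beVar_nonneg P N s
  have hβ2 : β ^ 2 ≤ 4 * S.beVar P N s + 2 := by
    have := pow_le_pow_left₀ (by linarith) hβ 2
    rwa [Real.sq_sqrt (by linarith)] at this
  have hlogB : 0 ≤ Real.log B := Real.log_natCast_nonneg B
  have hll : ∀ i ≠ s, 0 ≤ Real.log (Real.log
      (∑ j ∈ Finset.univ.erase s, 1 / (S.beGap P N s j) ^ 2)) +
        (|Real.log (Real.log (1 / αs ^ 2))| + 1) := by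
    intro i hi
    have hg := hΔ i hi
    have hgα : S.beGap P N s i ≤ αs := by
      have h1 := hS.beMean_le hN s
      have h2 := S.beMean_nonneg P N i
      rw [hαs] at h1
      unfold MetaSD.Decoding.beGap
      linarith
    have hα0 : 0 < αs := hg.trans_le hgα
    have hα1 : αs < 1 := by
      -- If αs = 1, the reward of `s` is almost surely 1 and has variance 0, which cannot exceed the
      -- variance of drafter i.
      refine lt_of_le_of_ne (hαs ▸ (hS.mean_mem_Icc s).2) fun h1 => ?_
      have hp : ∀ k ∈ Finset.range (N + 1),
          S.accProb P N s k * ((k : ℝ) / N - S.beMean P N s) ^ 2 = 0 := by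
        have hN0 : (N : ℝ) ≠ 0 := by positivity
        have hμ : S.beMean P N s = 1 := by
          have := hS.mul_beMean_eq hN s
          rw [hαs, h1] at this
          simpa [hN0] using this
        intro k hk
        have hkN := Nat.lt_succ_iff.1 (Finset.mem_range.1 hk)
        rw [MetaSD.Decoding.accProb, hS.measure_nAcc_eq s 0 hkN, hαs, h1, hμ]
        rcases hkN.lt_or_eq with h | rfl
        · simp [h]
        · simp [hN0]
      have := hvar i hi
      rw [S.beVar_eq N s, Finset.sum_eq_zero hp] at this
      exact absurd this (not_lt.2 (S.beVar_nonneg P N i))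
    -- The single term j = i suffices, because its gap is at most αs.
    have h1 : 1 / αs ^ 2 ≤ ∑ j ∈ Finset.univ.erase s, 1 / (S.beGap P N s j) ^ 2 := by
      refine le_trans ?_ (Finset.single_le_sum (f := fun j => 1 / (S.beGap P N s j) ^ 2)
        (fun j _ => by positivity) (Finset.mem_erase.2 ⟨hi, Finset.mem_univ i⟩))
      exact one_div_le_one_div_of_le (by positivity) (pow_le_pow_left₀ hg.le hgα 2)
    have h2 : 1 < 1 / αs ^ 2 := by
      rw [lt_div_iff₀ (by positivity), one_mul]
      exact pow_lt_one₀ hα0.le hα1 (by norm_num)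
    have h3 := Real.log_le_log (Real.log_pos h2) (Real.log_le_log (by positivity) h1)
    linarith [neg_abs_le (Real.log (Real.log (1 / αs ^ 2)))]
  have hterm : ∀ i ∈ Finset.univ.erase s,
      8 * β ^ 2 * Real.log B / S.beGap P N s i ^ 2 + K + 5 ≤
      (32 * S.beVar P N s + 16) / (S.beGap P N s i) ^ 2 *
        (Real.log B + Real.log (Real.log
          (∑ j ∈ Finset.univ.erase s, 1 / (S.beGap P N s j) ^ 2)) +
            (|Real.log (Real.log (1 / αs ^ 2))| + 1)) + (K + 5) := by
    intro i hi
    have hi := Finset.ne_of_mem_erase hi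
    have hg := hΔ i hi
    have h1 : 8 * β ^ 2 * Real.log B / S.beGap P N s i ^ 2 ≤
        (32 * S.beVar P N s + 16) / (S.beGap P N s i) ^ 2 * Real.log B := by
      rw [div_mul_eq_mul_div]
      gcongr
      linarith
    have h2 : 0 ≤ (32 * S.beVar P N s + 16) / (S.beGap P N s i) ^ 2 * (Real.log (Real.log
        (∑ j ∈ Finset.univ.erase s, 1 / (S.beGap P N s j) ^ 2)) +
          (|Real.log (Real.log (1 / αs ^ 2))| + 1)) :=
      mul_nonneg (by positivity) (hll i hi)
    rw [add_assoc (Real.log B), mul_add]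
    linarith
  have hsum := Finset.sum_le_sum hterm
  rw [Finset.sum_add_distrib (g := fun _ => (K : ℝ) + 5), Finset.sum_const, nsmul_eq_mul] at hsum
  have hcard : ((Finset.univ.erase s).card : ℝ) * (K + 5) ≤ K * (K + 5) := by
    gcongr
    exact (Finset.card_erase_le).trans_eq (Finset.card_fin K)
  linarith
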